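/- Let $(Z_k)_{k\in\mathbb Z}$ be i.i.d. real random variables with generic element $Z$, and let $(\mathbf A_k)_{k\in\mathbb Z}$, $\mathbf A_k=(A_{k,j})_{j\in\mathbb Z}$, be a stationary sequence of random real sequences, independent of $(Z_k)$. Assume that $Z$ is regularly varying with index $\alpha>0$: there is a nonzero measure $\mu$ on $\mathbb R\setminus\{0\}$, finite on $\{|x|\ge r\}$ for each $r>0$ and satisfying $\mu(uB)=u^{-\alpha}\mu(B)$ for all $u>0$ and all Borel $B$, such that $$\frac{E f(u^{-1}Z)}{P(|Z|>u)}\to\int f\,d\mu\qquad(u\to\infty)$$ for every bounded continuous $f:\mathbb R\to\mathbb R$ vanishing on a neighbourhood of $0$; if $\alpha>1$, assume also $EZ=0$. Assume further that for some $0<\varepsilon<\alpha$ $$\sum_{j} E|A_{0,j}|^{\alpha-\varepsilon}<\infty\ \text{ and }\ \sum_{j} E|A_{0,j}|^{\alpha+\varepsilon}<\infty,\quad\text{if }\alpha\in(0,1)\cup(1,2),$$ $$E\Big(\sum_{j}|A_{0,j}|^{\alpha-\varepsilon}\Big)^{\frac{\alpha+\varepsilon}{\alpha-\varepsilon}}<\infty,\quad\text{if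 }\alpha\in\{1,2\},$$ $$E\Big(\sum_{j}|A_{0,j}|^{2}\Big)^{\frac{\alpha+\varepsilon}{2}}<\infty,\quad\text{if }\alpha>2.$$ For an integer $q\ge0$ put $X^q_k=\sum_{|j|\le q}A_{k,j}Z_{k-j}$, $k\in\mathbb Z$. If $1<\alpha\le2$, then for every integer $q\ge0$ and every $\gamma>0$ $$\lim_{\delta\downarrow0}\ \limsup_{n\to\infty}\ \frac{P\Big(\sup_{k\le n}\Big|\sum_{i=1}^k X^q_i I\{|X^q_i|\le n\delta\}\Big|>n\gamma\Big)}{nP(|Z|>n)}=0.\qquad(*)$$ If $\alpha>2$ and $q\ge0$ is an integer such that for some $\beta>\alpha-1$ one has $E|A_{0,j}|^{2\beta}<\infty$ for all $-q\le j\le q$, then $(*)$ holds for this $q$ and every $\gamma>0$. -/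

import Mathlib

open MeasureTheory ProbabilityTheory Filter Topology
open scoped ENNReal Pointwise BoundedContinuousFunction

namespace HeavyTail

/-- Convergence in `M₀(E)`: integrals of every bounded continuous function that vanishes on a
neighbourhood of the origin converge. -/
def TendstoM0 {E ι : Type*} [NormedAddCommGroup E] [MeasurableSpace E]
    (m : ι → Measure E) (l : Filter ι) (m' : Measure E) : Prop :=
  ∀ f : E →ᵇ ℝ, (∃ r > 0, ∀ x : E, ‖x‖ < r → f x = 0) →
    Tendsto (fun i => ∫ x, f x ∂(m i)) l (𝓝 (∫ x, f x ∂m'))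

/-- `Z ∈ RV(μ, α)`: the random vector `Z` is regularly varying with limit measure `μ` and index
`α`.  A measure on `E \ {0}` is a measure on `E` that does not charge the origin. -/
structure IsRegularlyVarying {Ω E : Type*} [MeasurableSpace Ω] [NormedAddCommGroup E]
    [NormedSpace ℝ E] [MeasurableSpace E]
    (P : Measure Ω) (Z : Ω → E) (μ : Measure E) (α : ℝ) : Prop where
  index_pos : 0 < α
  ne_zero : μ ≠ 0
  origin_null : μ {0} = 0
  finite_away : ∀ r : ℝ, 0 < r → μ {x | r ≤ ‖x‖} < ∞
  tendsto : TendstoM0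
    (fun u : ℝ => (P {ω | u < ‖Z ω‖})⁻¹ • P.map (fun ω => u⁻¹ • Z ω)) atTop μ
  homogeneous : ∀ u : ℝ, 0 < u → ∀ B : Set E, MeasurableSet B →
    μ (u • B) = ENNReal.ofReal (u ^ (-α)) * μ B

/-- The moment conditions on the coefficients `a j` (to be used with `a j = A_{0,j}`), for an index
`α > 0`; which of the three cases applies is decided by `α`. -/
def CoefficientMoments {Ω : Type*} [MeasurableSpace Ω] (P : Measure Ω)
    (a : ℤ → Ω → ℝ) (α : ℝ) : Prop :=
  ∃ ε : ℝ, 0 < ε ∧ ε < α ∧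
    (α < 2 → α ≠ 1 →
      ∑' j, ∫⁻ ω, ‖a j ω‖ₑ ^ (α - ε) ∂P < ∞ ∧ ∑' j, ∫⁻ ω, ‖a j ω‖ₑ ^ (α + ε) ∂P < ∞) ∧
    (α = 1 ∨ α = 2 →
      ∫⁻ ω, (∑' j, ‖a j ω‖ₑ ^ (α - ε)) ^ ((α + ε) / (α - ε)) ∂P < ∞) ∧
    (2 < α →
      ∫⁻ ω, (∑' j, ‖a j ω‖ₑ ^ (2 : ℝ)) ^ ((α + ε) / 2) ∂P < ∞)

/-- The standing assumptions on the univariate random coefficient linear process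
`X_k = ∑_j A_{k,j} Z_{k-j}`: `(Z_k)` is i.i.d. and regularly varying (and centred if `α > 1`), the
sequence `k ↦ (A_{k,j})_j` is stationary and independent of `(Z_k)`, and the coefficients satisfy
the moment conditions. -/
structure LinearProcessAssumptions {Ω : Type*} [MeasurableSpace Ω] (P : Measure Ω)
    (A : ℤ → ℤ → Ω → ℝ) (Z : ℤ → Ω → ℝ) (μ : Measure ℝ) (α : ℝ) : Prop where
  measurable_coeff : ∀ k j, Measurable (A k j)
  measurable_noise : ∀ k, Measurable (Z k)
  noise_indep : iIndepFun Z P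
  noise_identDistrib : ∀ k, IdentDistrib (Z k) (Z 0) P P
  coeff_stationary : ∀ h : ℤ,
    IdentDistrib (fun ω (k j : ℤ) => A (k + h) j ω) (fun ω (k j : ℤ) => A k j ω) P P
  coeff_indep_noise : IndepFun (fun ω (k j : ℤ) => A k j ω) (fun ω (k : ℤ) => Z k ω) P
  noise_regularlyVarying : IsRegularlyVarying P (Z 0) μ α
  noise_centred : 1 < α → ∫ ω, Z 0 ω ∂P = 0
  coeff_moments : CoefficientMoments P (A 0) α

/-- The truncated process `X^q_k = ∑_{|j| ≤ q} A_{k,j} Z_{k-j}`. -/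
noncomputable def truncX {Ω : Type*} (A : ℤ → ℤ → Ω → ℝ) (Z : ℤ → Ω → ℝ) (q : ℕ) (k : ℤ) (ω : Ω) : ℝ :=
  ∑ j ∈ Finset.Icc (-(q : ℤ)) (q : ℤ), A k j ω * Z (k - j) ω

open Classical in
/-- The sum `∑_{i=1}^k X^q_i I{|X^q_i| ≤ c}`. -/
noncomputable def smallJumpSum {Ω : Type*} (A : ℤ → ℤ → Ω → ℝ) (Z : ℤ → Ω → ℝ) (q : ℕ)
    (c : ℝ) (k : ℕ) (ω : Ω) : ℝ :=
  ∑ i ∈ Finset.Icc 1 k, if |truncX A Z q (i : ℤ) ω| ≤ c then truncX A Z q (i : ℤ) ω else 0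

/-- `sup_{k ≤ n} |∑_{i=1}^k X^q_i I{|X^q_i| ≤ c}|`; the term with `k = 0` is zero and does not
affect the supremum. -/
noncomputable def smallJumpMax {Ω : Type*} (A : ℤ → ℤ → Ω → ℝ) (Z : ℤ → Ω → ℝ) (q : ℕ)
    (c : ℝ) (n : ℕ) (ω : Ω) : ℝ :=
  (Finset.range (n + 1)).sup' Finset.nonempty_range_add_one
    (fun k => |smallJumpSum A Z q c k ω|)

/-- The truncated small-jump maximal condition for a fixed `q` and `γ`:
`lim_{δ ↓ 0} limsup_n P(sup_{k ≤ n} |∑_{i=1}^k X^q_i I{|X^q_i| ≤ nδ}| > nγ) / (n P(|Z| > n)) = 0`.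
The quotient and the upper limit are taken in `[0, ∞]`. -/
def SmallJumpMaximalCondition {Ω : Type*} [MeasurableSpace Ω] (P : Measure Ω)
    (A : ℤ → ℤ → Ω → ℝ) (Z : ℤ → Ω → ℝ) (q : ℕ) (γ : ℝ) : Prop :=
  Tendsto
    (fun δ : ℝ => limsup
      (fun n : ℕ => P {ω | n * γ < smallJumpMax A Z q (n * δ) n ω} /
        ((n : ℝ≥0∞) * P {ω | (n : ℝ) < |Z 0 ω|})) atTop)
    (𝓝[>] 0) (𝓝 0)

end HeavyTail

namespace HeavyTail

/-! For fixed `j`, given the coefficients, the variables `A i j * Z (i - j)` are independent in `i`.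
Cut each at level `M = n ^ (1 - κ)`, slightly below `n`. If no summand of `X^q_i` exceeds `M`, then
`|X^q_i| ≤ (2q+1)M ≤ nδ` for large `n`, so the indicator is 1 and nothing is cut. Otherwise
replacing the small jump by the truncated summands costs at most `2nδ` per exceedance. With fewer
than `K` exceedances for each `j`, and `4(2q+1)Kδ ≤ γ`, the total error is at most `nγ/2`. Hence a
large maximum forces, for some `j`, either `K` exceedances or a large partial sum of truncated terms
(`exists_of_lt_smallJumpMax`).

On the event `∑ |A i j| ^ s ≤ M ^ s / n ^ κ`, exponential Markov inequalities conditional on the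
coefficients bound these two cases by multiples of `n ^ (-Kκ)` and `(n+1) exp(-g n ^ κ)`. The
complementary event is controlled by the moment of order `s * p`, and has probability of order at
most `n ^ (-(p(s-1) - κp(s+1)))`.

Regular variation gives `n P(|Z| > n) ≥ c n ^ (-ρ)` eventually, for any `ρ > α - 1`. If `p(s-1) > α
- 1`, there is room to choose `ρ`, then `κ` small, then `K` large, so that all three bounds are `o(n
^ (-ρ))`. The upper limit is therefore exactly zero for every sufficiently small `δ`. -/

/-- The truncation of `y` at level `M`. -/
noncomputable def trunc (M y : ℝ) : ℝ := if |y| ≤ M then y else 0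

open Classical in
/-- The number of `i ∈ s` for which `|y i|` exceeds `M`. -/
noncomputable def numExceed {ι : Type*} (s : Finset ι) (M : ℝ) (y : ι → ℝ) : ℕ :=
  (s.filter fun i => M < |y i|).card

theorem measurable_trunc (M : ℝ) : Measurable (trunc M) :=
  Measurable.ite (measurableSet_le measurable_norm measurable_const) measurable_id measurable_const

theorem abs_trunc_le {M : ℝ} (hM : 0 ≤ M) (y : ℝ) : |trunc M y| ≤ M := by
  unfold trunc
  split_ifs with h
  · exact h
  · simpa using hM

/-- The linear term on the right contains `y` itself and not its truncation, so it vanishes in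
expectation for centred `y` and no recentring is needed. Below the level, `|exp x - 1 - x| ≤ x ^ 2 ≤
|x| ^ s`; above it, the power absorbs the linear term. -/
theorem exp_trunc_div_le {M s : ℝ} (hM : 0 < M) (hs : 1 ≤ s) (hs2 : s ≤ 2) (σ : ℝ) (hσ : |σ| = 1)
    (y : ℝ) : Real.exp (σ * trunc M y / M) ≤ 1 + σ * y / M + (|y| / M) ^ s := by
  have habs : |σ * y / M| = |y| / M := by
    rw [abs_div, abs_mul, hσ, one_mul, abs_of_pos hM]
  unfold trunc
  split_ifs with h
  · have h1 : |y| / M ≤ 1 := (div_le_one hM).2 h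
    have h2 := Real.abs_exp_sub_one_sub_id_le (x := σ * y / M) (by rw [habs]; exact h1)
    have h3 : (σ * y / M) ^ 2 ≤ (|y| / M) ^ s := by
      rw [← sq_abs, habs, ← Real.rpow_natCast]
      rcases (by positivity : 0 ≤ |y| / M).eq_or_lt with h0 | h0
      · rw [← h0, Real.zero_rpow (by norm_num), Real.zero_rpow (by linarith)]
      · exact Real.rpow_le_rpow_of_exponent_ge h0 h1 (by exact_mod_cast hs2)
    linarith [le_abs_self (Real.exp (σ * y / M) - 1 - σ * y / M)]
  · have h1 : 1 ≤ |y| / M := (one_le_div hM).2 (not_le.1 h).le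
    have h2 : |y| / M ≤ (|y| / M) ^ s := by
      conv_lhs => rw [← Real.rpow_one (|y| / M)]
      exact Real.rpow_le_rpow_of_exponent_le h1 hs
    simp only [mul_zero, zero_div, Real.exp_zero]
    linarith [neg_abs_le (σ * y / M)]

theorem ite_exceed_le {M s b : ℝ} (hM : 0 < M) (hs : 0 ≤ s) (hb : 0 ≤ b) (y : ℝ) :
    (if M < |y| then b else 1) ≤ 1 + b * (|y| / M) ^ s := by
  have h0 : 0 ≤ (|y| / M) ^ s := by positivity
  split_ifs with h
  · have h1 : 1 ≤ (|y| / M) ^ s := Real.one_le_rpow ((one_le_div hM).2 h.le) hs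
    nlinarith
  · nlinarith

/-! ### Exponential bounds for deterministic coefficients -/

section Chernoff

variable {Ω ι : Type*} [MeasurableSpace Ω] {P : Measure Ω}

theorem measure_exp_le_prod_le {W : ι → Ω → ℝ} (hW : iIndepFun W P)
    (hmeas : ∀ i, Measurable (W i)) (hpos : ∀ i ω, 0 ≤ W i ω) (s : Finset ι) (c : ι → ℝ)
    (hc : ∀ i ∈ s, ∫⁻ ω, ENNReal.ofReal (W i ω) ∂P ≤ ENNReal.ofReal (Real.exp (c i))) (x : ℝ) :
    P {ω | Real.exp x ≤ ∏ i ∈ s, W i ω} ≤ ENNReal.ofReal (Real.exp (∑ i ∈ s, c i - x)) := by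
  have h1 : ∫⁻ ω, ENNReal.ofReal (∏ i ∈ s, W i ω) ∂P
      ≤ ENNReal.ofReal (Real.exp (∑ i ∈ s, c i)) := by
    have h2 := lintegral_prod_eq_prod_lintegral_of_indepFun s
      (fun i ω => ENNReal.ofReal (W i ω))
      (hW.comp (fun _ => ENNReal.ofReal) fun _ => ENNReal.measurable_ofReal)
      (fun i => (hmeas i).ennreal_ofReal)
    simp_rw [ENNReal.ofReal_prod_of_nonneg (fun i _ => hpos i _)]
    rw [h2, Real.exp_sum, ENNReal.ofReal_prod_of_nonneg (fun i _ => (Real.exp_pos _).le)]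
    exact Finset.prod_le_prod' hc
  have h3 : P {ω | ENNReal.ofReal (Real.exp x) ≤ ENNReal.ofReal (∏ i ∈ s, W i ω)}
      ≤ (∫⁻ ω, ENNReal.ofReal (∏ i ∈ s, W i ω) ∂P) / ENNReal.ofReal (Real.exp x) :=
    meas_ge_le_lintegral_div
      (Finset.measurable_prod s fun i _ => hmeas i).ennreal_ofReal.aemeasurable
      (by simpa using Real.exp_pos x) ENNReal.ofReal_ne_top
  rw [Real.exp_sub, ENNReal.ofReal_div_of_pos (Real.exp_pos x)]
  refine (measure_mono fun ω hω => ?_).trans (h3.trans (ENNReal.div_le_div_right h1 _))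
  exact ENNReal.ofReal_le_ofReal hω

variable {Y : ι → Ω → ℝ} {s C : ℝ}

/-- The linear term integrates to zero, and `1 + x ≤ exp x` turns the rest into an exponential. The
free slope `r` lets this serve both the truncated sums and the exceedance counts, where `r = 0`. -/
theorem lintegral_le_of_le_affine [IsProbabilityMeasure P] {Y : Ω → ℝ} (hint : Integrable Y P)
    (hcen : ∫ ω, Y ω ∂P = 0) (hints : Integrable (fun ω => |Y ω| ^ s) P)
    (hC : ∫ ω, |Y ω| ^ s ∂P = C) (a r k : ℝ) (W : Ω → ℝ) (hpos : ∀ ω, 0 ≤ W ω)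
    (hW : ∀ ω, W ω ≤ 1 + r * Y ω + k * (|a| ^ s * |Y ω| ^ s)) :
    ∫⁻ ω, ENNReal.ofReal (W ω) ∂P ≤ ENNReal.ofReal (Real.exp (k * (|a| ^ s * C))) := by
  have hi : Integrable (fun ω => 1 + r * Y ω + k * (|a| ^ s * |Y ω| ^ s)) P :=
    ((integrable_const 1).add (hint.const_mul r)).add ((hints.const_mul _).const_mul _)
  calc ∫⁻ ω, ENNReal.ofReal (W ω) ∂P
      ≤ ∫⁻ ω, ENNReal.ofReal (1 + r * Y ω + k * (|a| ^ s * |Y ω| ^ s)) ∂P :=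
        lintegral_mono fun ω => ENNReal.ofReal_le_ofReal (hW ω)
    _ = ENNReal.ofReal (∫ ω, (1 + r * Y ω + k * (|a| ^ s * |Y ω| ^ s)) ∂P) :=
        (ofReal_integral_eq_lintegral_ofReal hi
          (Eventually.of_forall fun ω => (hpos ω).trans (hW ω))).symm
    _ ≤ _ := by
        apply ENNReal.ofReal_le_ofReal
        have h1 : Integrable (fun ω => 1 + r * Y ω) P := (integrable_const 1).add (hint.const_mul r)
        rw [integral_add h1 ((hints.const_mul _).const_mul _), integral_add (integrable_const 1) (hint.const_mul r),
          integral_const_mul, integral_const_mul, integral_const_mul, hcen, hC]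
        have := Real.add_one_le_exp (k * (|a| ^ s * C))
        simp only [integral_const, probReal_univ, smul_eq_mul]
        linarith

theorem measure_lt_abs_sum_trunc_le [IsProbabilityMeasure P] (hY : iIndepFun Y P)
    (hmeas : ∀ i, Measurable (Y i)) (hint : ∀ i, Integrable (Y i) P)
    (hcen : ∀ i, ∫ ω, Y i ω ∂P = 0) (hints : ∀ i, Integrable (fun ω => |Y i ω| ^ s) P)
    (hC : ∀ i, ∫ ω, |Y i ω| ^ s ∂P = C) (hs : 1 ≤ s) (hs2 : s ≤ 2) {M : ℝ} (hM : 0 < M)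
    (t : Finset ι) (a : ι → ℝ) (x : ℝ) :
    P {ω | x < |∑ i ∈ t, trunc M (a i * Y i ω)|} ≤
      2 * ENNReal.ofReal (Real.exp (C / M ^ s * ∑ i ∈ t, |a i| ^ s - x / M)) := by
  have key : ∀ σ : ℝ, |σ| = 1 → P {ω | x < σ * ∑ i ∈ t, trunc M (a i * Y i ω)} ≤
      ENNReal.ofReal (Real.exp (C / M ^ s * ∑ i ∈ t, |a i| ^ s - x / M)) := by
    intro σ hσ
    have hm : ∀ i, Measurable fun y : ℝ => Real.exp (σ * trunc M (a i * y) / M) := fun i =>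
      Real.measurable_exp.comp
        ((((measurable_trunc M).comp (measurable_id.const_mul (a i))).const_mul σ).div_const M)
    have h := measure_exp_le_prod_le
      (W := fun i ω => Real.exp (σ * trunc M (a i * Y i ω) / M))
      (hY.comp (fun i y => Real.exp (σ * trunc M (a i * y) / M)) hm)
      (fun i => (hm i).comp (hmeas i)) (fun i ω => (Real.exp_pos _).le) t
      (fun i => 1 / M ^ s * (|a i| ^ s * C)) (fun i _ => by
        refine lintegral_le_of_le_affine (hint i) (hcen i) (hints i) (hC i) (a i) (σ * a i / M) _ _
          (fun ω => (Real.exp_pos _).le) fun ω => ?_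
        refine (exp_trunc_div_le hM hs hs2 σ hσ _).trans (le_of_eq ?_)
        rw [Real.div_rpow (abs_nonneg _) hM.le, abs_mul,
          Real.mul_rpow (abs_nonneg _) (abs_nonneg _)]
        ring) (x / M)
    have hsum : ∑ i ∈ t, 1 / M ^ s * (|a i| ^ s * C) = C / M ^ s * ∑ i ∈ t, |a i| ^ s := by
      rw [Finset.mul_sum]
      exact Finset.sum_congr rfl fun i _ => by ring
    rw [hsum] at h
    refine (measure_mono fun ω hω => ?_).trans h
    simp only [Set.mem_ofPred_eq] at hω ⊢
    rw [← Real.exp_sum, ← Finset.sum_div, ← Finset.mul_sum]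
    exact Real.exp_le_exp.2 (div_le_div_of_nonneg_right hω.le hM.le)
  rw [two_mul]
  refine (measure_mono fun ω hω => ?_).trans ((measure_union_le _ _).trans
    (add_le_add (key 1 (by simp)) (key (-1) (by simp))))
  simpa [lt_abs] using hω

/-- Chernoff's bound with weight `b` for each exceedance: the product of the weights is `b` to the
number of exceedances. -/
theorem measure_le_numExceed_le [IsProbabilityMeasure P] (hY : iIndepFun Y P)
    (hmeas : ∀ i, Measurable (Y i)) (hint : ∀ i, Integrable (Y i) P)
    (hcen : ∀ i, ∫ ω, Y i ω ∂P = 0) (hints : ∀ i, Integrable (fun ω => |Y i ω| ^ s) P)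
    (hC : ∀ i, ∫ ω, |Y i ω| ^ s ∂P = C) (hs : 0 ≤ s) {M : ℝ} (hM : 0 < M)
    (t : Finset ι) (a : ι → ℝ) {b : ℝ} (hb : 1 ≤ b) (K : ℕ) :
    P {ω | K ≤ numExceed t M fun i => a i * Y i ω} ≤
      ENNReal.ofReal (Real.exp (b * C / M ^ s * ∑ i ∈ t, |a i| ^ s - K * Real.log b)) := by
  classical
  have hm : ∀ i, Measurable fun y : ℝ => if M < |a i * y| then b else 1 := fun i =>
    Measurable.ite (measurableSet_lt measurable_const (measurable_id.const_mul (a i)).norm)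
      measurable_const measurable_const
  have hpos : ∀ i ω, 0 ≤ if M < |a i * Y i ω| then b else 1 := fun i ω => by
    split_ifs <;> linarith
  have h := measure_exp_le_prod_le
    (W := fun i ω => if M < |a i * Y i ω| then b else 1)
    (hY.comp (fun i y => if M < |a i * y| then b else 1) hm)
    (fun i => (hm i).comp (hmeas i)) hpos t
    (fun i => b / M ^ s * (|a i| ^ s * C)) (fun i _ => by
      refine lintegral_le_of_le_affine (hint i) (hcen i) (hints i) (hC i) (a i) 0 _ _
        (hpos i) fun ω => ?_
      refine (ite_exceed_le hM hs (by linarith) _).trans (le_of_eq ?_)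
      rw [Real.div_rpow (abs_nonneg _) hM.le, abs_mul,
        Real.mul_rpow (abs_nonneg _) (abs_nonneg _)]
      ring) (K * Real.log b)
  have hsum : ∑ i ∈ t, b / M ^ s * (|a i| ^ s * C) = b * C / M ^ s * ∑ i ∈ t, |a i| ^ s := by
    rw [Finset.mul_sum]
    exact Finset.sum_congr rfl fun i _ => by ring
  rw [hsum] at h
  refine (measure_mono fun ω hω => ?_).trans h
  simp only [Set.mem_ofPred_eq] at hω ⊢
  rw [Finset.prod_ite, Finset.prod_const, Finset.prod_const_one, mul_one, mul_comm, Real.exp_mul,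
    Real.exp_log (by linarith), Real.rpow_natCast]
  refine pow_le_pow_right₀ hb (hω.trans (le_of_eq ?_))
  unfold numExceed
  congr

end Chernoff

/-! ### Tail bounds and moments from regular variation -/

section RegularVariation

/-- A continuous function that vanishes on `|x| ≤ r` and equals one on `r' ≤ |x|`. -/
noncomputable def ramp (r r' : ℝ) : ℝ →ᵇ ℝ :=
  BoundedContinuousFunction.ofNormedAddCommGroup
    (fun x : ℝ => max 0 (min 1 ((|x| - r) / (r' - r))))
    (by fun_prop) 1 (fun x => by
      rw [Real.norm_eq_abs, abs_of_nonneg (le_max_left _ _)]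
      exact max_le zero_le_one (min_le_left _ _))

theorem ramp_nonneg (r r' x : ℝ) : 0 ≤ ramp r r' x := le_max_left _ _

theorem ramp_le_one (r r' x : ℝ) : ramp r r' x ≤ 1 := max_le zero_le_one (min_le_left _ _)

theorem ramp_eq_zero {r r' x : ℝ} (h : r < r') (hx : |x| ≤ r) : ramp r r' x = 0 :=
  max_eq_left ((min_le_right _ _).trans
    (div_nonpos_of_nonpos_of_nonneg (by linarith) (by linarith)))

theorem ramp_eq_one {r r' x : ℝ} (h : r < r') (hx : r' ≤ |x|) : ramp r r' x = 1 := by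
  have h1 : 1 ≤ (|x| - r) / (r' - r) := (one_le_div (by linarith)).2 (by linarith)
  change max 0 (min 1 ((|x| - r) / (r' - r))) = 1
  rw [min_eq_left h1, max_eq_right zero_le_one]

variable {Ω : Type*} [MeasurableSpace Ω] {P : Measure Ω} {Z : Ω → ℝ} {μ : Measure ℝ} {α : ℝ}

theorem measurableSet_le_abs (r : ℝ) : MeasurableSet {x : ℝ | r ≤ |x|} :=
  measurableSet_le measurable_const measurable_norm

theorem IsRegularlyVarying.measure_le_abs (h : IsRegularlyVarying P Z μ α) {r : ℝ} (hr : 0 < r) :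
    μ {x : ℝ | r ≤ |x|} = ENNReal.ofReal (r ^ (-α)) * μ {x : ℝ | 1 ≤ |x|} := by
  rw [← h.homogeneous r hr _ (measurableSet_le_abs 1)]
  congr 1
  ext x
  rw [Set.mem_smul_set_iff_inv_smul_mem₀ hr.ne']
  simp only [Set.mem_ofPred_eq, smul_eq_mul, abs_mul, abs_inv, abs_of_pos hr]
  rw [inv_mul_eq_div, one_le_div hr]

/-- By homogeneity, nullity of this one set would pass to every set `r ≤ |x|`, and these exhaust the
complement of the origin. -/
theorem IsRegularlyVarying.measure_one_le_abs_ne_zero (h : IsRegularlyVarying P Z μ α) :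
    μ {x : ℝ | 1 ≤ |x|} ≠ 0 := by
  intro h0
  apply h.ne_zero
  rw [← Measure.measure_univ_eq_zero]
  have hsub : (Set.univ : Set ℝ) ⊆ {0} ∪ ⋃ n : ℕ, {x : ℝ | 1 / ((n : ℝ) + 1) ≤ |x|} := by
    intro x _
    by_cases hx : x = 0
    · exact Or.inl hx
    · obtain ⟨n, hn⟩ := exists_nat_one_div_lt (abs_pos.2 hx)
      exact Or.inr (Set.mem_iUnion.2 ⟨n, hn.le⟩)
  refine measure_mono_null hsub (measure_union_null h.origin_null (measure_iUnion_null fun n => ?_))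
  rw [h.measure_le_abs (by positivity), h0, mul_zero]

theorem IsRegularlyVarying.measure_le_abs_ne_top (h : IsRegularlyVarying P Z μ α) {r : ℝ}
    (hr : 0 < r) : μ {x : ℝ | r ≤ |x|} ≠ ∞ := (h.finite_away r hr).ne

theorem IsRegularlyVarying.measureReal_one_le_abs_pos (h : IsRegularlyVarying P Z μ α) :
    0 < μ.real {x : ℝ | 1 ≤ |x|} :=
  ENNReal.toReal_pos h.measure_one_le_abs_ne_zero (h.measure_le_abs_ne_top one_pos)

theorem IsRegularlyVarying.measureReal_le_abs (h : IsRegularlyVarying P Z μ α) {r : ℝ}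
    (hr : 0 < r) : μ.real {x : ℝ | r ≤ |x|} = r ^ (-α) * μ.real {x : ℝ | 1 ≤ |x|} := by
  rw [Measure.real, h.measure_le_abs hr, ENNReal.toReal_mul,
    ENNReal.toReal_ofReal (by positivity), Measure.real]

theorem ramp_le_indicator {r r' : ℝ} (h : r < r') (x : ℝ) :
    ramp r r' x ≤ {x : ℝ | r ≤ |x|}.indicator (fun _ => 1) x := by
  by_cases hx : x ∈ {x : ℝ | r ≤ |x|}
  · rw [Set.indicator_of_mem hx]
    exact ramp_le_one _ _ _
  · rw [Set.indicator_of_notMem hx, ramp_eq_zero h (not_le.1 (show ¬ r ≤ |x| from hx)).le]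

theorem indicator_le_ramp {r r' : ℝ} (h : r < r') (x : ℝ) :
    {x : ℝ | r' ≤ |x|}.indicator (fun _ => 1) x ≤ ramp r r' x := by
  by_cases hx : x ∈ {x : ℝ | r' ≤ |x|}
  · rw [Set.indicator_of_mem hx, ramp_eq_one h hx]
  · rw [Set.indicator_of_notMem hx]
    exact ramp_nonneg _ _ _

theorem IsRegularlyVarying.integral_ramp_bounds (h : IsRegularlyVarying P Z μ α) {r r' : ℝ}
    (hr : 0 < r) (hr' : r < r') :
    r' ^ (-α) * μ.real {x : ℝ | 1 ≤ |x|} ≤ ∫ x, ramp r r' x ∂μ ∧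
      ∫ x, ramp r r' x ∂μ ≤ r ^ (-α) * μ.real {x : ℝ | 1 ≤ |x|} := by
  have hind : ∀ t : ℝ, 0 < t →
      Integrable ({x : ℝ | t ≤ |x|}.indicator (fun _ => (1 : ℝ))) μ := fun t ht =>
    (integrable_indicator_iff (measurableSet_le_abs t)).2
      (integrableOn_const (h.measure_le_abs_ne_top ht))
  have hi : Integrable (fun x => ramp r r' x) μ :=
    (hind r hr).mono' (ramp r r').continuous.aestronglyMeasurable
      (Eventually.of_forall fun x => by
        rw [Real.norm_eq_abs, abs_of_nonneg (ramp_nonneg _ _ _)]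
        exact ramp_le_indicator hr' x)
  have hint : ∀ t : ℝ, 0 < t → ∫ x, {x : ℝ | t ≤ |x|}.indicator (fun _ => (1 : ℝ)) x ∂μ =
      t ^ (-α) * μ.real {x : ℝ | 1 ≤ |x|} := fun t ht => by
    rw [integral_indicator (measurableSet_le_abs t), setIntegral_const, smul_eq_mul, mul_one,
      h.measureReal_le_abs ht]
  rw [← hint r hr, ← hint r' (hr.trans hr')]
  exact ⟨integral_mono (hind r' (hr.trans hr')) hi (indicator_le_ramp hr'),
    integral_mono hi (hind r hr) (ramp_le_indicator hr')⟩

theorem integral_ramp_map_bounds [IsProbabilityMeasure P] (hZ : Measurable Z) {r r' u : ℝ}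
    (hr' : r < r') (hu : 0 < u) :
    P.real {ω | r' * u < |Z ω|} ≤ ∫ x, ramp r r' x ∂(P.map fun ω => u⁻¹ • Z ω) ∧
      ∫ x, ramp r r' x ∂(P.map fun ω => u⁻¹ • Z ω) ≤ P.real {ω | r * u < |Z ω|} := by
  have hm : ∀ t : ℝ, MeasurableSet {ω | t < |Z ω|} := fun t =>
    measurableSet_lt measurable_const hZ.norm
  have hind : ∀ t : ℝ, Integrable ({ω | t < |Z ω|}.indicator (fun _ => (1 : ℝ))) P := fun t =>
    (integrable_const 1).indicator (hm t)
  have hint : ∀ t : ℝ, ∫ ω, {ω | t < |Z ω|}.indicator (fun _ => (1 : ℝ)) ω ∂P =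
      P.real {ω | t < |Z ω|} := fun t => by
    rw [integral_indicator (hm t), setIntegral_const, smul_eq_mul, mul_one]
  have hZu : Measurable fun ω => u⁻¹ • Z ω := hZ.const_mul u⁻¹
  have habs : ∀ ω, |u⁻¹ • Z ω| = |Z ω| / u := fun ω => by
    rw [smul_eq_mul, abs_mul, abs_inv, abs_of_pos hu, inv_mul_eq_div]
  have hi : Integrable (fun ω => ramp r r' (u⁻¹ • Z ω)) P :=
    (integrable_const 1).mono' ((ramp r r').continuous.measurable.comp hZu).aestronglyMeasurable
      (Eventually.of_forall fun x => by
        rw [Real.norm_eq_abs, abs_of_nonneg (ramp_nonneg _ _ _)]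
        exact ramp_le_one _ _ _)
  rw [integral_map hZu.aemeasurable (ramp r r').continuous.aestronglyMeasurable, ← hint, ← hint]
  constructor
  · refine integral_mono (hind _) hi fun ω => ?_
    by_cases hω : r' * u < |Z ω|
    · have : ω ∈ {ω | r' * u < |Z ω|} := hω
      simp only [Set.indicator_of_mem this]
      rw [ramp_eq_one hr']
      rw [habs, le_div_iff₀ hu]
      exact hω.le
    · have : ω ∉ {ω | r' * u < |Z ω|} := hω
      simp only [Set.indicator_of_notMem this]
      exact ramp_nonneg _ _ _
  · refine integral_mono hi (hind _) fun ω => ?_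
    by_cases hω : r * u < |Z ω|
    · have : ω ∈ {ω | r * u < |Z ω|} := hω
      simp only [Set.indicator_of_mem this]
      exact ramp_le_one _ _ _
    · have : ω ∉ {ω | r * u < |Z ω|} := hω
      simp only [Set.indicator_of_notMem this]
      rw [ramp_eq_zero hr']
      rw [habs, div_le_iff₀ hu]
      exact not_lt.1 hω

theorem IsRegularlyVarying.tendsto_ramp (h : IsRegularlyVarying P Z μ α) {r r' : ℝ}
    (hr : 0 < r) (hr' : r < r') :
    Tendsto (fun u : ℝ => (P.real {ω | u < |Z ω|})⁻¹ *
      ∫ x, ramp r r' x ∂(P.map fun ω => u⁻¹ • Z ω)) atTop (𝓝 (∫ x, ramp r r' x ∂μ)) := by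
  refine (h.tendsto (ramp r r') ⟨r, hr, fun x hx => ramp_eq_zero hr' hx.le⟩).congr fun u => ?_
  rw [integral_smul_measure, ENNReal.toReal_inv, smul_eq_mul]
  rfl

theorem IsRegularlyVarying.eventually_tail_pos (h : IsRegularlyVarying P Z μ α) :
    ∀ᶠ u : ℝ in atTop, 0 < P.real {ω | u < |Z ω|} := by
  have hI := (h.integral_ramp_bounds one_pos one_lt_two).1
  have hV := h.measureReal_one_le_abs_pos
  filter_upwards [(h.tendsto_ramp one_pos one_lt_two).eventually_const_lt
    (show (0 : ℝ) < ∫ x, ramp 1 2 x ∂μ from lt_of_lt_of_le (by positivity) hI)] with u hu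
  refine lt_of_le_of_ne measureReal_nonneg fun h0 => ?_
  rw [← h0] at hu
  simp at hu

/-- A half of Potter's bounds at a single ratio `l`. Sandwiching the tail with a continuous ramp
loses a constant factor, which a large `l` absorbs because `s < α`. -/
theorem IsRegularlyVarying.eventually_tail_mul_le [IsProbabilityMeasure P]
    (h : IsRegularlyVarying P Z μ α) (hZ : Measurable Z) {s : ℝ} (hs : s < α) :
    ∃ l : ℝ, 1 < l ∧ ∀ᶠ u : ℝ in atTop,
      P.real {ω | l * u < |Z ω|} ≤ l ^ (-s) * P.real {ω | u < |Z ω|} := by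
  set V := μ.real {x : ℝ | 1 ≤ |x|}
  have hV : 0 < V := h.measureReal_one_le_abs_pos
  -- The ramp from `l / 2` to `l` has integral at most `2 ^ α * V * l ^ (-α)`, which is below `l ^
  -- (-s)` once `l ^ (α - s) > 2 ^ α * V`.
  obtain ⟨l, hl, hl1⟩ := (((tendsto_rpow_atTop (sub_pos.2 hs)).eventually_gt_atTop
    (2 ^ α * V)).and (eventually_gt_atTop 1)).exists
  refine ⟨l, hl1, ?_⟩
  have hl0 : 0 < l := by linarith
  have hlt : ∫ x, ramp (l / 2) l x ∂μ < l ^ (-s) := by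
    refine ((h.integral_ramp_bounds (half_pos hl0) (half_lt_self hl0)).2).trans_lt ?_
    rw [Real.div_rpow hl0.le zero_le_two, Real.rpow_neg zero_le_two, div_inv_eq_mul]
    rw [show -s = -α + (α - s) by ring, Real.rpow_add hl0]
    have : 0 < l ^ (-α) := by positivity
    nlinarith
  filter_upwards [(h.tendsto_ramp (half_pos hl0) (half_lt_self hl0)).eventually_lt_const hlt,
    h.eventually_tail_pos, eventually_gt_atTop 0] with u hu hpos hu0
  rw [inv_mul_lt_iff₀ hpos, mul_comm] at hu
  exact (integral_ramp_map_bounds hZ (half_lt_self hl0) hu0).1.trans hu.le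

theorem IsRegularlyVarying.eventually_le_tail_mul [IsProbabilityMeasure P]
    (h : IsRegularlyVarying P Z μ α) (hZ : Measurable Z) {s : ℝ} (hs : α < s) :
    ∃ l : ℝ, 1 < l ∧ ∀ᶠ u : ℝ in atTop,
      l ^ (-s) * P.real {ω | u < |Z ω|} ≤ P.real {ω | l * u < |Z ω|} := by
  set V := μ.real {x : ℝ | 1 ≤ |x|}
  have hV : 0 < V := h.measureReal_one_le_abs_pos
  obtain ⟨l, hl, hl1⟩ := (((tendsto_rpow_atTop (sub_pos.2 hs)).eventually_gt_atTop
    (2 ^ α / V)).and (eventually_gt_atTop 1)).exists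
  refine ⟨l, hl1, ?_⟩
  have hl0 : 0 < l := by linarith
  have hl2 : l < 2 * l := by linarith
  have hlt : l ^ (-s) < ∫ x, ramp l (2 * l) x ∂μ := by
    refine lt_of_lt_of_le ?_ ((h.integral_ramp_bounds hl0 hl2).1)
    rw [div_lt_iff₀ hV] at hl
    rw [Real.mul_rpow zero_le_two hl0.le, Real.rpow_neg zero_le_two,
      show -α = -s + (s - α) by ring, Real.rpow_add hl0]
    have h1 : 0 < l ^ (-s) := by positivity
    have h2 : (0 : ℝ) < 2 ^ α := by positivity
    rw [mul_assoc, inv_mul_eq_div, lt_div_iff₀ h2]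
    change _ < l ^ (-s) * l ^ (s - α) * V
    nlinarith
  filter_upwards [(h.tendsto_ramp hl0 hl2).eventually_const_lt hlt,
    h.eventually_tail_pos, eventually_gt_atTop 0] with u hu hpos hu0
  rw [lt_inv_mul_iff₀ hpos, mul_comm] at hu
  exact hu.le.trans (integral_ramp_map_bounds hZ hl2 hu0).2

/-- Iterate the one-ratio bound along `l ^ j * u₀`, then interpolate by monotonicity of the tail;
interpolation only costs a factor in `c`. -/
theorem IsRegularlyVarying.exists_rpow_le_tail [IsProbabilityMeasure P]
    (h : IsRegularlyVarying P Z μ α) (hZ : Measurable Z) {s : ℝ} (hs : α < s) :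
    ∃ c : ℝ, 0 < c ∧ ∀ᶠ u : ℝ in atTop, c * u ^ (-s) ≤ P.real {ω | u < |Z ω|} := by
  obtain ⟨l, hl1, hl⟩ := h.eventually_le_tail_mul hZ hs
  have hl0 : 0 < l := by linarith
  have hs0 : 0 < s := h.index_pos.trans hs
  obtain ⟨u₀, hu₀⟩ := eventually_atTop.1
    (hl.and (h.eventually_tail_pos.and (eventually_gt_atTop 0)))
  obtain ⟨-, hp, hu⟩ := hu₀ u₀ le_rfl
  have hiter : ∀ j : ℕ, (l ^ j) ^ (-s) * P.real {ω | u₀ < |Z ω|} ≤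
      P.real {ω | l ^ j * u₀ < |Z ω|} := by
    intro j
    induction j with
    | zero => simp
    | succ j ih =>
      have h1 := (hu₀ (l ^ j * u₀) (le_mul_of_one_le_left hu.le (one_le_pow₀ hl1.le))).1
      rw [pow_succ', mul_assoc l, Real.mul_rpow hl0.le (by positivity), mul_assoc]
      exact (mul_le_mul_of_nonneg_left ih (by positivity)).trans h1
  refine ⟨l ^ (-s) * u₀ ^ s * P.real {ω | u₀ < |Z ω|}, by positivity, ?_⟩
  filter_upwards [eventually_ge_atTop u₀] with x hx
  have hx0 : 0 < x := hu.trans_le hx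
  obtain ⟨j, hj1, hj2⟩ := exists_nat_pow_near ((one_le_div hu).2 hx) hl1
  have h2 : P.real {ω | l ^ (j + 1) * u₀ < |Z ω|} ≤ P.real {ω | x < |Z ω|} :=
    measureReal_mono fun ω hω => ((div_lt_iff₀ hu).1 hj2).trans hω
  refine le_trans ?_ ((hiter (j + 1)).trans h2)
  have h3 : (x / u₀) ^ (-s) ≤ (l ^ j) ^ (-s) :=
    Real.rpow_le_rpow_of_nonpos (by positivity) hj1 (by linarith)
  rw [Real.div_rpow hx0.le hu.le, Real.rpow_neg hu.le, div_inv_eq_mul] at h3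
  rw [pow_succ', Real.mul_rpow hl0.le (by positivity)]
  calc _ = l ^ (-s) * (x ^ (-s) * u₀ ^ s) * P.real {ω | u₀ < |Z ω|} := by ring
    _ ≤ _ := by gcongr

theorem exists_pow_mul_lt_le {x u l : ℝ} (hx : u < x) (hu : 0 < u) (hl : 1 < l) :
    ∃ j : ℕ, l ^ j * u < x ∧ x ≤ l ^ (j + 1) * u := by
  classical
  have hex : ∃ n : ℕ, x ≤ l ^ n * u := by
    obtain ⟨n, hn⟩ := pow_unbounded_of_one_lt (x / u) hl
    exact ⟨n, ((div_lt_iff₀ hu).1 hn).le⟩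
  have h0 : Nat.find hex ≠ 0 := fun h => by
    have := Nat.find_spec hex
    rw [h, pow_zero, one_mul] at this
    linarith
  obtain ⟨j, hj⟩ := Nat.exists_eq_succ_of_ne_zero h0
  refine ⟨j, not_le.1 (Nat.find_min hex (by omega)), ?_⟩
  have := Nat.find_spec hex
  rwa [hj] at this

/-- Split the range of `|Z|` at the points `l ^ j * u₀`. With `s < t < α`, the tail there is at most
`l ^ (-t * j)`, so the moment is dominated by a geometric series of ratio `l ^ (s - t)`. -/
theorem IsRegularlyVarying.integrable_rpow [IsProbabilityMeasure P]
    (h : IsRegularlyVarying P Z μ α) (hZ : Measurable Z) {s : ℝ} (hs0 : 0 ≤ s) (hs : s < α) :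
    Integrable (fun ω => |Z ω| ^ s) P := by
  obtain ⟨t, hst, ht⟩ := exists_between hs
  obtain ⟨l, hl1, hl⟩ := h.eventually_tail_mul_le hZ ht
  have hl0 : 0 < l := by linarith
  obtain ⟨u₀, hu₀⟩ := eventually_atTop.1 (hl.and (eventually_gt_atTop 0))
  obtain ⟨-, hu⟩ := hu₀ u₀ le_rfl
  have hiter : ∀ j : ℕ, P.real {ω | l ^ j * u₀ < |Z ω|} ≤ (l ^ (-t)) ^ j := by
    intro j
    induction j with
    | zero => simp
    | succ j ih =>
      have h1 := (hu₀ (l ^ j * u₀) (le_mul_of_one_le_left hu.le (one_le_pow₀ hl1.le))).1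
      rw [pow_succ', mul_assoc l, pow_succ']
      exact h1.trans (mul_le_mul_of_nonneg_left ih (by positivity))
  have hm : Measurable fun ω => |Z ω| ^ s := hZ.norm.pow_const s
  have hE : ∀ j : ℕ, MeasurableSet {ω | l ^ j * u₀ < |Z ω|} := fun j =>
    measurableSet_lt measurable_const hZ.norm
  have hbound : ∀ ω, ENNReal.ofReal (|Z ω| ^ s) ≤ ENNReal.ofReal (u₀ ^ s) +
      ∑' j : ℕ, {ω | l ^ j * u₀ < |Z ω|}.indicator
        (fun _ => ENNReal.ofReal ((l ^ (j + 1) * u₀) ^ s)) ω := by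
    intro ω
    by_cases hω : |Z ω| ≤ u₀
    · exact le_add_right (ENNReal.ofReal_le_ofReal (Real.rpow_le_rpow (abs_nonneg _) hω hs0))
    · rw [not_le] at hω
      obtain ⟨j, hj1, hj2⟩ := exists_pow_mul_lt_le hω hu hl1
      refine le_add_left (le_trans ?_ (ENNReal.le_tsum j))
      have : ω ∈ {ω | l ^ j * u₀ < |Z ω|} := hj1
      rw [Set.indicator_of_mem this]
      exact ENNReal.ofReal_le_ofReal (Real.rpow_le_rpow (abs_nonneg _) hj2 hs0)
  have hr : l ^ (s - t) < 1 := Real.rpow_lt_one_of_one_lt_of_neg hl1 (by linarith)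
  refine ⟨hm.aestronglyMeasurable, ?_⟩
  rw [hasFiniteIntegral_iff_ofReal (Eventually.of_forall fun ω => by positivity)]
  refine (lintegral_mono hbound).trans_lt ?_
  rw [lintegral_add_left measurable_const, lintegral_const, measure_univ, mul_one,
    lintegral_tsum fun j => (measurable_const.indicator (hE j)).aemeasurable]
  refine ENNReal.add_lt_top.2 ⟨ENNReal.ofReal_lt_top, ?_⟩
  have hterm : ∀ j : ℕ, ∫⁻ ω, {ω | l ^ j * u₀ < |Z ω|}.indicator
      (fun _ => ENNReal.ofReal ((l ^ (j + 1) * u₀) ^ s)) ω ∂P ≤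
      ENNReal.ofReal ((l * u₀) ^ s) * ENNReal.ofReal (l ^ (s - t)) ^ j := by
    intro j
    rw [lintegral_indicator (hE j), setLIntegral_const, ← ENNReal.ofReal_toReal
      (measure_ne_top P {ω | l ^ j * u₀ < |Z ω|}), ← ENNReal.ofReal_mul (by positivity),
      ← ENNReal.ofReal_pow (by positivity), ← ENNReal.ofReal_mul (by positivity)]
    apply ENNReal.ofReal_le_ofReal
    refine (mul_le_mul_of_nonneg_left (hiter j) (by positivity)).trans (le_of_eq ?_)
    rw [pow_succ, mul_assoc, Real.mul_rpow (by positivity) (by positivity), sub_eq_add_neg,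
      Real.rpow_add hl0, mul_pow, ← Real.rpow_natCast (l ^ s), ← Real.rpow_mul hl0.le,
      ← Real.rpow_natCast l, ← Real.rpow_mul hl0.le, mul_comm s]
    ring
  refine (ENNReal.tsum_le_tsum hterm).trans_lt ?_
  rw [ENNReal.tsum_mul_left, ENNReal.tsum_geometric]
  refine ENNReal.mul_lt_top ENNReal.ofReal_lt_top (ENNReal.inv_lt_top.2 ?_)
  rw [tsub_pos_iff_lt]
  exact ENNReal.ofReal_lt_one.2 hr

end RegularVariation

theorem numExceed_eq_sum {ι : Type*} (s : Finset ι) (M : ℝ) (y : ι → ℝ) :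
    numExceed s M y = ∑ i ∈ s, if M < |y i| then 1 else 0 := by
  unfold numExceed
  rw [Finset.card_filter]

theorem numExceed_mono {ι : Type*} {s t : Finset ι} (h : s ⊆ t) (M : ℝ) (y : ι → ℝ) :
    numExceed s M y ≤ numExceed t M y :=
  Finset.card_le_card (Finset.filter_subset_filter _ h)

/-! ### Pathwise comparison of small jumps with truncated summands -/

section Decomposition

variable {ι κ : Type*}

open Classical in
-- Without exceedances both quantities equal the full sum. With at least one, each is bounded by
-- `c`, so a difference of `2 * c` is paid for by that exceedance.
theorem abs_ite_sub_sum_trunc_le (J : Finset κ) (y : κ → ℝ) {M c : ℝ} (hM : 0 ≤ M)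
    (hc : J.card * M ≤ c) :
    |(if |∑ j ∈ J, y j| ≤ c then ∑ j ∈ J, y j else 0) - ∑ j ∈ J, trunc M (y j)| ≤
      2 * c * ∑ j ∈ J, if M < |y j| then 1 else 0 := by
  have hc0 : 0 ≤ c := le_trans (by positivity) hc
  by_cases h : ∀ j ∈ J, |y j| ≤ M
  · have h1 : ∑ j ∈ J, trunc M (y j) = ∑ j ∈ J, y j :=
      Finset.sum_congr rfl fun j hj => if_pos (h j hj)
    have h2 : |∑ j ∈ J, y j| ≤ c := by
      refine (Finset.abs_sum_le_sum_abs _ _).trans ((Finset.sum_le_card_nsmul _ _ M h).trans ?_)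
      rwa [nsmul_eq_mul]
    rw [if_pos h2, h1, sub_self, abs_zero]
    refine mul_nonneg (by positivity) (Finset.sum_nonneg fun j _ => ?_)
    split_ifs <;> norm_num
  · push Not at h
    obtain ⟨j, hj, hjM⟩ := h
    have h1 : (1 : ℝ) ≤ ∑ j ∈ J, if M < |y j| then (1 : ℝ) else 0 := by
      have := Finset.single_le_sum (f := fun j => if M < |y j| then (1 : ℝ) else 0)
        (fun j _ => by split_ifs <;> norm_num) hj
      simpa [if_pos hjM] using this
    have h2 : |∑ j ∈ J, trunc M (y j)| ≤ c := by
      refine (Finset.abs_sum_le_sum_abs _ _).trans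
        ((Finset.sum_le_card_nsmul _ _ M fun j _ => abs_trunc_le hM _).trans ?_)
      rwa [nsmul_eq_mul]
    have h3 : |if |∑ j ∈ J, y j| ≤ c then ∑ j ∈ J, y j else 0| ≤ c := by
      split_ifs with h
      · exact h
      · simpa using hc0
    refine (abs_sub _ _).trans ?_
    nlinarith

open Classical in
theorem abs_sum_ite_sub_sum_trunc_le (I : Finset ι) (J : Finset κ) (y : ι → κ → ℝ) {M c : ℝ}
    (hM : 0 ≤ M) (hc : J.card * M ≤ c) :
    |(∑ i ∈ I, if |∑ j ∈ J, y i j| ≤ c then ∑ j ∈ J, y i j else 0) -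
        ∑ j ∈ J, ∑ i ∈ I, trunc M (y i j)| ≤
      2 * c * ∑ j ∈ J, (numExceed I M fun i => y i j : ℝ) := by
  rw [Finset.sum_comm, ← Finset.sum_sub_distrib]
  refine (Finset.abs_sum_le_sum_abs _ _).trans
    ((Finset.sum_le_sum fun i _ => abs_ite_sub_sum_trunc_le J (y i) hM hc).trans (le_of_eq ?_))
  rw [← Finset.mul_sum, Finset.sum_comm]
  congr 1
  refine Finset.sum_congr rfl fun j _ => ?_
  rw [numExceed_eq_sum]
  push_cast
  rfl

variable {Ω : Type*}

theorem exists_of_lt_smallJumpMax {A : ℤ → ℤ → Ω → ℝ} {Z : ℤ → Ω → ℝ} {q n K : ℕ} {c x M : ℝ}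
    {ω : Ω} (hM : 0 ≤ M) (hc : (2 * q + 1) * M ≤ c)
    (hK : 4 * (2 * q + 1) * K * c ≤ x) (h : x < smallJumpMax A Z q c n ω) :
    ∃ j ∈ Finset.Icc (-(q : ℤ)) q,
      K ≤ numExceed (Finset.Icc 1 n) M (fun i : ℕ => A i j ω * Z (i - j) ω) ∨
      ∃ k ∈ Finset.range (n + 1),
        x / (2 * (2 * q + 1)) < |∑ i ∈ Finset.Icc 1 k, trunc M (A i j ω * Z (i - j) ω)| := by
  by_contra! hcon
  obtain ⟨k, hk, hlt⟩ := (Finset.lt_sup'_iff _).1 h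
  have hcard : ((Finset.Icc (-(q : ℤ)) q).card : ℝ) = 2 * q + 1 := by
    rw [Int.card_Icc]
    have : ((q : ℤ) + 1 - -(q : ℤ)).toNat = 2 * q + 1 := by omega
    rw [this]
    push_cast
    ring
  have hc0 : 0 ≤ c := le_trans (by positivity) hc
  have hsub : Finset.Icc 1 k ⊆ Finset.Icc 1 n :=
    Finset.Icc_subset_Icc_right (by simpa [Nat.lt_succ_iff] using hk)
  have h1 := abs_sum_ite_sub_sum_trunc_le (Finset.Icc 1 k) (Finset.Icc (-(q : ℤ)) q)
    (fun (i : ℕ) j => A i j ω * Z (i - j) ω) hM (c := c) (by rw [hcard]; exact hc)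
  have h2 : |∑ j ∈ Finset.Icc (-(q : ℤ)) q, ∑ i ∈ Finset.Icc 1 k,
      trunc M (A i j ω * Z (i - j) ω)| ≤ x / 2 := by
    refine (Finset.abs_sum_le_sum_abs _ _).trans
      ((Finset.sum_le_card_nsmul _ _ _ fun j hj => (hcon j hj).2 k hk).trans (le_of_eq ?_))
    rw [nsmul_eq_mul, hcard]
    field_simp
  have h3 : ∑ j ∈ Finset.Icc (-(q : ℤ)) q, (numExceed (Finset.Icc 1 k) M
      (fun i : ℕ => A i j ω * Z (i - j) ω) : ℝ) ≤ (2 * q + 1) * K := by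
    refine (Finset.sum_le_card_nsmul _ _ (K : ℝ) fun j hj => ?_).trans (le_of_eq ?_)
    · exact_mod_cast (numExceed_mono hsub _ _).trans (hcon j hj).1.le
    · rw [nsmul_eq_mul, hcard]
  have h4 := mul_le_mul_of_nonneg_left h3 (show 0 ≤ 2 * c by positivity)
  have h5 := abs_sub_abs_le_abs_sub (smallJumpSum A Z q c k ω)
    (∑ j ∈ Finset.Icc (-(q : ℤ)) q, ∑ i ∈ Finset.Icc 1 k, trunc M (A i j ω * Z (i - j) ω))
  have h6 := h5.trans h1
  linarith

end Decomposition

/-! ### Conditioning on the random coefficients -/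

section Conditional

variable {Ω : Type*} [MeasurableSpace Ω] {P : Measure Ω}

/-- Fubini: under independence the joint law is a product, so a bound uniform over the sections
passes to the whole set. -/
theorem measure_le_of_indepFun [IsProbabilityMeasure P] {E F : Type*} [MeasurableSpace E]
    [MeasurableSpace F] {U : Ω → E} {V : Ω → F} (hUV : IndepFun U V P) (hU : Measurable U)
    (hV : Measurable V) {S : Set (E × F)} (hS : MeasurableSet S) {c : ℝ≥0∞}
    (hc : ∀ u, P {ω | (u, V ω) ∈ S} ≤ c) : P {ω | (U ω, V ω) ∈ S} ≤ c := by
  have := Measure.isProbabilityMeasure_map (μ := P) hU.aemeasurable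
  have := Measure.isProbabilityMeasure_map (μ := P) hV.aemeasurable
  have h := hUV.map_prod_eq_prod_map_map hU.aemeasurable hV.aemeasurable
  change P ((fun ω => (U ω, V ω)) ⁻¹' S) ≤ c
  rw [← Measure.map_apply (hU.prodMk hV) hS, h, Measure.prod_apply hS]
  refine (lintegral_mono (g := fun _ => c) fun u => ?_).trans (by simp)
  rw [Measure.map_apply hV (measurable_prodMk_left hS)]
  exact hc u

variable {a Y : ℕ → Ω → ℝ} {s C : ℝ}

theorem measure_numExceed_or_trunc_le [IsProbabilityMeasure P]
    (haY : IndepFun (fun ω i => a i ω) (fun ω i => Y i ω) P) (ha : ∀ i, Measurable (a i))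
    (hY : iIndepFun Y P)
    (hmeas : ∀ i, Measurable (Y i)) (hint : ∀ i, Integrable (Y i) P)
    (hcen : ∀ i, ∫ ω, Y i ω ∂P = 0) (hints : ∀ i, Integrable (fun ω => |Y i ω| ^ s) P)
    (hC : ∀ i, ∫ ω, |Y i ω| ^ s ∂P = C) (hs : 1 ≤ s) (hs2 : s ≤ 2) {M b : ℝ} (hM : 0 < M)
    (hb : 1 ≤ b) (n K : ℕ) (x L : ℝ) :
    P {ω | K ≤ numExceed (Finset.Icc 1 n) M (fun i => a i ω * Y i ω) ∨
      ∃ k ∈ Finset.range (n + 1), x < |∑ i ∈ Finset.Icc 1 k, trunc M (a i ω * Y i ω)|} ≤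
    P {ω | L < ∑ i ∈ Finset.Icc 1 n, |a i ω| ^ s} +
      (ENNReal.ofReal (Real.exp (b * C / M ^ s * L - K * Real.log b)) +
        (n + 1) * (2 * ENNReal.ofReal (Real.exp (C / M ^ s * L - x / M)))) := by
  have hC0 : 0 ≤ C := by
    rw [← hC 0]
    exact integral_nonneg fun ω => by positivity
  -- Building the constraint on the coefficients into `S` makes the sections over bad coefficients
  -- empty, so the conditional bound is uniform.
  set S : Set ((ℕ → ℝ) × (ℕ → ℝ)) := {p | ∑ i ∈ Finset.Icc 1 n, |p.1 i| ^ s ≤ L ∧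
    (K ≤ numExceed (Finset.Icc 1 n) M (fun i => p.1 i * p.2 i) ∨
      ∃ k ∈ Finset.range (n + 1), x < |∑ i ∈ Finset.Icc 1 k, trunc M (p.1 i * p.2 i)|)} with hSdef
  have hmul : ∀ i : ℕ, Measurable fun p : (ℕ → ℝ) × (ℕ → ℝ) => p.1 i * p.2 i := fun i => by
    fun_prop
  have hS : MeasurableSet S := by
    refine MeasurableSet.inter ?_ (MeasurableSet.union ?_ ?_)
    · have h : Measurable fun p : (ℕ → ℝ) × (ℕ → ℝ) => ∑ i ∈ Finset.Icc 1 n, |p.1 i| ^ s :=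
        Finset.measurable_sum _ fun i _ =>
          (((measurable_pi_apply i).comp measurable_fst).norm.pow_const s)
      exact measurableSet_le h measurable_const
    · have h : Measurable fun p : (ℕ → ℝ) × (ℕ → ℝ) =>
          numExceed (Finset.Icc 1 n) M (fun i => p.1 i * p.2 i) := by
        simp_rw [numExceed_eq_sum]
        exact Finset.measurable_sum _ fun i _ =>
          Measurable.ite (measurableSet_lt measurable_const (hmul i).norm)
            measurable_const measurable_const
      exact measurableSet_le measurable_const h
    · have : {p : (ℕ → ℝ) × (ℕ → ℝ) | ∃ k ∈ Finset.range (n + 1),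
          x < |∑ i ∈ Finset.Icc 1 k, trunc M (p.1 i * p.2 i)|} =
          ⋃ k ∈ Finset.range (n + 1),
            {p | x < |∑ i ∈ Finset.Icc 1 k, trunc M (p.1 i * p.2 i)|} := by
        ext p
        simp
      change MeasurableSet {p : (ℕ → ℝ) × (ℕ → ℝ) | ∃ k ∈ Finset.range (n + 1),
          x < |∑ i ∈ Finset.Icc 1 k, trunc M (p.1 i * p.2 i)|}
      rw [this]
      exact Finset.measurableSet_biUnion _ fun k _ => measurableSet_lt measurable_const
        (Finset.measurable_sum _ fun i _ => (measurable_trunc M).comp (hmul i)).norm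
  have hcond := measure_le_of_indepFun (c :=
      ENNReal.ofReal (Real.exp (b * C / M ^ s * L - K * Real.log b)) +
        (n + 1) * (2 * ENNReal.ofReal (Real.exp (C / M ^ s * L - x / M)))) haY
    (measurable_pi_lambda _ ha) (measurable_pi_lambda _ hmeas) hS fun u => by
    by_cases hu : ∑ i ∈ Finset.Icc 1 n, |u i| ^ s ≤ L
    · refine (measure_mono (t := {ω | K ≤ numExceed (Finset.Icc 1 n) M fun i => u i * Y i ω} ∪
        ⋃ k ∈ Finset.range (n + 1),
          {ω | x < |∑ i ∈ Finset.Icc 1 k, trunc M (u i * Y i ω)|}) fun ω hω => ?_).trans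
        ((measure_union_le _ _).trans (add_le_add ?_ ?_))
      · rcases hω.2 with h | ⟨k, hk, h⟩
        · exact Or.inl h
        · exact Or.inr (Set.mem_biUnion (Finset.mem_coe.2 hk) h)
      · refine (measure_le_numExceed_le hY hmeas hint hcen hints hC (by linarith) hM _ u hb K).trans
          (ENNReal.ofReal_le_ofReal (Real.exp_le_exp.2 (sub_le_sub_right ?_ _)))
        exact mul_le_mul_of_nonneg_left hu (by positivity)
      -- A crude union bound over `k` suffices in place of a maximal inequality: the factor `n + 1`
      -- is harmless against the exponential decay used later.
      · refine (measure_biUnion_finset_le _ _).trans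
          ((Finset.sum_le_card_nsmul _ _ _ fun k hk => ?_).trans (le_of_eq (by
            rw [Finset.card_range, nsmul_eq_mul, Nat.cast_succ])))
        refine (measure_lt_abs_sum_trunc_le hY hmeas hint hcen hints hC hs hs2 hM _ u x).trans ?_
        gcongr
        refine le_trans (Finset.sum_le_sum_of_subset_of_nonneg
          (Finset.Icc_subset_Icc_right ?_) fun i _ _ => by positivity) hu
        simpa [Nat.lt_succ_iff] using hk
    · have : {ω | (u, fun i => Y i ω) ∈ S} = ∅ := by
        ext ω
        simp only [Set.mem_empty_iff_false, iff_false]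
        exact fun h => hu h.1
      rw [this, measure_empty]
      exact zero_le
  refine le_trans (measure_mono fun ω hω => ?_) ((measure_union_le _ _).trans
    (add_le_add le_rfl hcond))
  by_cases h : ∑ i ∈ Finset.Icc 1 n, |a i ω| ^ s ≤ L
  · exact Or.inr ⟨h, hω⟩
  · exact Or.inl (not_le.1 h)

/-- Markov's inequality at order `p` with the power mean inequality. It needs no independence among
the coefficients, only a common moment. -/
theorem measure_lt_sum_rpow_le (ha : ∀ i, Measurable (a i)) {p : ℝ} {D : ℝ≥0∞}
    (hs : 0 ≤ s) (hp : 1 ≤ p) (hD : ∀ i, ∫⁻ ω, ‖a i ω‖ₑ ^ (s * p) ∂P = D) (n : ℕ) {L : ℝ}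
    (hL : 0 < L) :
    P {ω | L < ∑ i ∈ Finset.Icc 1 n, |a i ω| ^ s} ≤ ENNReal.ofReal ((n / L) ^ p) * D := by
  have hp0 : 0 < p := by linarith
  have hLp : 0 < L ^ p := by positivity
  have hrw : ∀ ω, ENNReal.ofReal ((∑ i ∈ Finset.Icc 1 n, |a i ω| ^ s) ^ p) =
      (∑ i ∈ Finset.Icc 1 n, ‖a i ω‖ₑ ^ s) ^ p := fun ω => by
    rw [← ENNReal.ofReal_rpow_of_nonneg (Finset.sum_nonneg fun i _ => by positivity) hp0.le,
      ENNReal.ofReal_sum_of_nonneg fun i _ => by positivity]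
    congr 1
    refine Finset.sum_congr rfl fun i _ => ?_
    rw [← ENNReal.ofReal_rpow_of_nonneg (abs_nonneg _) hs, Real.enorm_eq_ofReal_abs]
  have hm : Measurable fun ω => (∑ i ∈ Finset.Icc 1 n, ‖a i ω‖ₑ ^ s) ^ p :=
    (Finset.measurable_sum _ fun i _ => (ha i).enorm.pow_const s).pow_const p
  have h1 : ∫⁻ ω, (∑ i ∈ Finset.Icc 1 n, ‖a i ω‖ₑ ^ s) ^ p ∂P ≤ (n : ℝ≥0∞) ^ p * D := by
    calc ∫⁻ ω, (∑ i ∈ Finset.Icc 1 n, ‖a i ω‖ₑ ^ s) ^ p ∂P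
        ≤ ∫⁻ ω, (n : ℝ≥0∞) ^ (p - 1) * ∑ i ∈ Finset.Icc 1 n, ‖a i ω‖ₑ ^ (s * p) ∂P := by
          refine lintegral_mono fun ω => ?_
          have := ENNReal.rpow_sum_le_const_mul_sum_rpow (Finset.Icc 1 n)
            (fun i => ‖a i ω‖ₑ ^ s) hp
          simpa only [Nat.card_Icc, Nat.add_sub_cancel, ← ENNReal.rpow_mul] using this
      _ = (n : ℝ≥0∞) ^ (p - 1) * (n * D) := by
          rw [lintegral_const_mul _ (Finset.measurable_sum _ fun i _ => (ha i).enorm.pow_const _),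
            lintegral_finsetSum _ fun i _ => (ha i).enorm.pow_const _]
          simp [hD]
      _ = (n : ℝ≥0∞) ^ p * D := by
          rw [← mul_assoc]
          congr 1
          rcases Nat.eq_zero_or_pos n with h0 | h0
          · simp [h0, ENNReal.zero_rpow_of_pos hp0]
          · conv_lhs => rw [← ENNReal.rpow_one (n : ℝ≥0∞), ← ENNReal.rpow_mul]
            rw [one_mul, ← ENNReal.rpow_add _ _ (by exact_mod_cast h0.ne')
              (ENNReal.natCast_ne_top n), sub_add_cancel]
  calc P {ω | L < ∑ i ∈ Finset.Icc 1 n, |a i ω| ^ s}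
      ≤ P {ω | ENNReal.ofReal (L ^ p) ≤ (∑ i ∈ Finset.Icc 1 n, ‖a i ω‖ₑ ^ s) ^ p} := by
        refine measure_mono fun ω hω => ?_
        simp only [Set.mem_ofPred_eq] at hω ⊢
        rw [← hrw]
        exact ENNReal.ofReal_le_ofReal (Real.rpow_le_rpow hL.le hω.le hp0.le)
    _ ≤ (∫⁻ ω, (∑ i ∈ Finset.Icc 1 n, ‖a i ω‖ₑ ^ s) ^ p ∂P) / ENNReal.ofReal (L ^ p) :=
        meas_ge_le_lintegral_div hm.aemeasurable (by simpa using hLp) ENNReal.ofReal_ne_top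
    _ ≤ (n : ℝ≥0∞) ^ p * D / ENNReal.ofReal (L ^ p) := ENNReal.div_le_div_right h1 _
    _ = _ := by
        rw [Real.div_rpow (Nat.cast_nonneg n) hL.le, ENNReal.ofReal_div_of_pos hLp,
          ← ENNReal.ofReal_rpow_of_nonneg (Nat.cast_nonneg n) hp0.le, ENNReal.ofReal_natCast,
          ENNReal.div_eq_inv_mul, ENNReal.div_eq_inv_mul, mul_assoc]

end Conditional

/-! ### Bounds for the linear process and choice of exponents -/

section LinearProcess

variable {Ω : Type*} [MeasurableSpace Ω] {P : Measure Ω}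
  {A : ℤ → ℤ → Ω → ℝ} {Z : ℤ → Ω → ℝ} {μ : Measure ℝ} {α : ℝ}

theorem LinearProcessAssumptions.lintegral_coeff_eq (hX : LinearProcessAssumptions P A Z μ α)
    (r : ℝ) (i j : ℤ) : ∫⁻ ω, ‖A i j ω‖ₑ ^ r ∂P = ∫⁻ ω, ‖A 0 j ω‖ₑ ^ r ∂P := by
  have h := ((hX.coeff_stationary i).comp (u := fun f : ℤ → ℤ → ℝ => ‖f 0 j‖ₑ ^ r)
    (by fun_prop)).lintegral_eq
  simpa [Function.comp_def] using h

theorem LinearProcessAssumptions.measure_lt_smallJumpMax_le [IsProbabilityMeasure P]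
    (hX : LinearProcessAssumptions P A Z μ α) (hα : 1 < α) {s p κ : ℝ} (hs : 1 ≤ s) (hs2 : s ≤ 2)
    (hsα : s < α) (hp : 1 ≤ p) (hκ : 0 < κ) {q n K : ℕ} {γ δ : ℝ} (hn : 1 ≤ n)
    (hM : (2 * q + 1) * (n : ℝ) ^ (1 - κ) ≤ n * δ) (hK : 4 * (2 * q + 1) * K * δ ≤ γ) :
    P {ω | n * γ < smallJumpMax A Z q (n * δ) n ω} ≤ ∑ j ∈ Finset.Icc (-(q : ℤ)) q,
      (ENNReal.ofReal ((n : ℝ) ^ (-(p * (s * (1 - κ) - κ - 1)))) *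
          ∫⁻ ω, ‖A 0 j ω‖ₑ ^ (s * p) ∂P +
        (ENNReal.ofReal (Real.exp (∫ ω, |Z 0 ω| ^ s ∂P) * (n : ℝ) ^ (-(K * κ))) +
          (n + 1) * (2 * ENNReal.ofReal (Real.exp (∫ ω, |Z 0 ω| ^ s ∂P) *
            Real.exp (-(γ / (2 * (2 * q + 1)) * (n : ℝ) ^ κ)))))) := by
  have hn0 : (0 : ℝ) < n := by exact_mod_cast hn
  have hn1 : (1 : ℝ) ≤ n := by exact_mod_cast hn
  set C := ∫ ω, |Z 0 ω| ^ s ∂P with hCdef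
  have hC0 : 0 ≤ C := integral_nonneg fun ω => by positivity
  -- These scales are matched: `b / M ^ s * L = 1` keeps the variance-type term bounded by `C`, `b ^
  -- (-K) = n ^ (-Kκ)` bounds the count, and `n / M = n ^ κ` drives the exponential decay.
  set M : ℝ := (n : ℝ) ^ (1 - κ) with hMdef
  have hM0 : 0 < M := by positivity
  set b : ℝ := (n : ℝ) ^ κ with hbdef
  have hb0 : 0 < b := by positivity
  have hb1 : 1 ≤ b := Real.one_le_rpow hn1 hκ.le
  set L : ℝ := M ^ s / b with hLdef
  have hMs : 0 < M ^ s := by positivity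
  have hL0 : 0 < L := by positivity
  have hZ := hX.noise_regularlyVarying
  have hZs := hZ.integrable_rpow (hX.measurable_noise 0) (by linarith) hsα
  have hZ1 : Integrable (Z 0) P := by
    have h := hZ.integrable_rpow (hX.measurable_noise 0) zero_le_one hα
    simp only [Real.rpow_one] at h
    exact (integrable_norm_iff (hX.measurable_noise 0).aestronglyMeasurable).1 h
  have hpow : Measurable fun x : ℝ => |x| ^ s := measurable_norm.pow_const s
  have hid := hX.noise_identDistrib
  have hint : ∀ k, Integrable (Z k) P := fun k => (hid k).integrable_iff.2 hZ1
  have hcen : ∀ k, ∫ ω, Z k ω ∂P = 0 := fun k => (hid k).integral_eq.trans (hX.noise_centred hα)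
  have hints : ∀ k, Integrable (fun ω => |Z k ω| ^ s) P := fun k =>
    ((hid k).comp hpow).integrable_iff.2 hZs
  have hC : ∀ k, ∫ ω, |Z k ω| ^ s ∂P = C := fun k => ((hid k).comp hpow).integral_eq
  have hsub : {ω | n * γ < smallJumpMax A Z q (n * δ) n ω} ⊆
      ⋃ j ∈ Finset.Icc (-(q : ℤ)) q,
        {ω | K ≤ numExceed (Finset.Icc 1 n) M (fun i : ℕ => A i j ω * Z (i - j) ω) ∨
          ∃ k ∈ Finset.range (n + 1), n * γ / (2 * (2 * q + 1)) <
            |∑ i ∈ Finset.Icc 1 k, trunc M (A i j ω * Z (i - j) ω)|} := by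
    intro ω hω
    obtain ⟨j, hj, h⟩ := exists_of_lt_smallJumpMax hM0.le hM
      (by have := mul_le_mul_of_nonneg_left hK hn0.le; linarith) hω
    exact Set.mem_biUnion (Finset.mem_coe.2 hj) h
  refine (measure_mono hsub).trans ((measure_biUnion_finset_le _ _).trans
    (Finset.sum_le_sum fun j _ => ?_))
  -- Fixing `j` makes the noise indices `i - j` distinct; this restores independence although the
  -- `X^q_i` themselves share noise variables.
  have hinj : Function.Injective fun i : ℕ => (i : ℤ) - j := fun i i' h => by
    simpa using h
  have haY : IndepFun (fun ω (i : ℕ) => A i j ω) (fun ω (i : ℕ) => Z (i - j) ω) P :=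
    hX.coeff_indep_noise.comp (φ := fun (f : ℤ → ℤ → ℝ) (i : ℕ) => f i j)
      (ψ := fun (f : ℤ → ℝ) (i : ℕ) => f (i - j)) (by fun_prop) (by fun_prop)
  have h := measure_numExceed_or_trunc_le (a := fun i : ℕ => A i j)
    (Y := fun i : ℕ => Z (i - j)) (s := s) (C := C) haY (fun i => hX.measurable_coeff i j)
    (hX.noise_indep.precomp hinj) (fun i => hX.measurable_noise _) (fun i => hint _)
    (fun i => hcen _) (fun i => hints _) (fun i => hC _) hs hs2 hM0 hb1 n K
    (n * γ / (2 * (2 * q + 1))) L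
  refine h.trans (add_le_add ?_ (add_le_add ?_ ?_))
  · refine (measure_lt_sum_rpow_le (fun i : ℕ => hX.measurable_coeff i j) (by linarith) hp
      (fun i => hX.lintegral_coeff_eq (s * p) i j) n hL0).trans (le_of_eq ?_)
    congr 2
    rw [hLdef, hMdef, hbdef, ← Real.rpow_mul hn0.le, ← Real.rpow_sub hn0]
    conv_lhs => rw [← Real.rpow_one (n : ℝ)]
    rw [← Real.rpow_mul hn0.le, ← Real.rpow_sub hn0, ← Real.rpow_mul hn0.le]
    congr 1
    ring
  · apply ENNReal.ofReal_le_ofReal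
    have h1 : b * C / M ^ s * L = C := by
      rw [hLdef]
      field_simp
    rw [h1, sub_eq_add_neg, Real.exp_add, hbdef, Real.log_rpow hn0, Real.rpow_def_of_pos hn0]
    apply le_of_eq
    congr 2
    ring
  · gcongr
    rw [← Real.exp_add]
    apply Real.exp_le_exp.2
    have h1 : C / M ^ s * L ≤ C := by
      have : C / M ^ s * L = C / b := by
        rw [hLdef]
        field_simp
      rw [this]
      exact div_le_self hC0 hb1
    have h2 : (n : ℝ) / M = b := by
      rw [hMdef, hbdef]
      conv_lhs => rw [← Real.rpow_one (n : ℝ)]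
      rw [← Real.rpow_mul hn0.le, ← Real.rpow_sub hn0]
      congr 1
      ring
    have h3 : n * γ / (2 * (2 * q + 1)) / M = γ / (2 * (2 * q + 1)) * b := by
      rw [← h2]
      ring
    rw [h3]
    linarith

theorem tendsto_natCast_rpow_mul_rpow_neg {x y : ℝ} (h : x < y) :
    Tendsto (fun n : ℕ => (n : ℝ) ^ (-y) * (n : ℝ) ^ x) atTop (𝓝 0) := by
  have h1 := (tendsto_rpow_neg_atTop (sub_pos.2 h)).comp tendsto_natCast_atTop_atTop
  refine h1.congr' ?_
  filter_upwards [eventually_gt_atTop 0] with n hn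
  rw [Function.comp_apply, ← Real.rpow_add (by exact_mod_cast hn)]
  congr 1
  ring

theorem tendsto_natCast_mul_exp_neg_rpow_mul_rpow {g κ : ℝ} (hg : 0 < g) (hκ : 0 < κ) (x : ℝ) :
    Tendsto (fun n : ℕ => ((n : ℝ) + 1) * Real.exp (-(g * (n : ℝ) ^ κ)) * (n : ℝ) ^ x)
      atTop (𝓝 0) := by
  have h1 : ∀ y : ℝ, Tendsto (fun n : ℕ => (n : ℝ) ^ y * Real.exp (-(g * (n : ℝ) ^ κ)))
      atTop (𝓝 0) := fun y => by
    have h2 := ((tendsto_rpow_mul_exp_neg_mul_atTop_nhds_zero (y / κ) g hg).comp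
      (tendsto_rpow_atTop hκ)).comp tendsto_natCast_atTop_atTop
    refine h2.congr fun n => ?_
    simp only [Function.comp_apply]
    rw [← Real.rpow_mul (Nat.cast_nonneg n), mul_div_cancel₀ _ hκ.ne', neg_mul]
  have h3 := (h1 (1 + x)).add (h1 x)
  rw [add_zero] at h3
  refine h3.congr' ?_
  filter_upwards [eventually_gt_atTop 0] with n hn
  rw [Real.rpow_add (by exact_mod_cast hn), Real.rpow_one]
  ring

theorem LinearProcessAssumptions.smallJumpMaximalCondition [IsProbabilityMeasure P]
    (hX : LinearProcessAssumptions P A Z μ α) (hα : 1 < α) {s p : ℝ} (hs : 1 ≤ s) (hs2 : s ≤ 2)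
    (hsα : s < α) (hp : 1 ≤ p) (hsp : α - 1 < p * (s - 1)) {q : ℕ}
    (hA : ∀ j ∈ Finset.Icc (-(q : ℤ)) q, ∫⁻ ω, ‖A 0 j ω‖ₑ ^ (s * p) ∂P < ∞) {γ : ℝ}
    (hγ : 0 < γ) : SmallJumpMaximalCondition P A Z q γ := by
  obtain ⟨ρ, hρ1, hρ2⟩ := exists_between hsp
  -- The exponent from the coefficients is `p(s-1) - κp(s+1)`; this `κ` spends half of its margin
  -- over `ρ`.
  set κ := (p * (s - 1) - ρ) / (2 * (p * (s + 1))) with hκdef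
  have hden : 0 < p * (s + 1) := by positivity
  have hκ : 0 < κ := div_pos (by linarith) (by linarith)
  have hτ : ρ < p * (s * (1 - κ) - κ - 1) := by
    have : κ * (p * (s + 1)) = (p * (s - 1) - ρ) / 2 := by
      rw [hκdef]
      field_simp
    nlinarith
  -- `K` depends on neither `n` nor `δ`, so `δ` can be taken small afterwards.
  obtain ⟨K, hK⟩ := exists_nat_gt (ρ / κ)
  rw [div_lt_iff₀ hκ] at hK
  obtain ⟨c, hc, htail⟩ := hX.noise_regularlyVarying.exists_rpow_le_tail
    (hX.measurable_noise 0) (show α < ρ + 1 by linarith)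
  set J := Finset.Icc (-(q : ℤ)) q
  set C := ∫ ω, |Z 0 ω| ^ s ∂P
  set g := γ / (2 * (2 * q + 1))
  have hg : 0 < g := by positivity
  set D : ℤ → ℝ := fun j => (∫⁻ ω, ‖A 0 j ω‖ₑ ^ (s * p) ∂P).toReal
  set R : ℕ → ℝ := fun n => ∑ j ∈ J, ((n : ℝ) ^ (-(p * (s * (1 - κ) - κ - 1))) * D j +
    (Real.exp C * (n : ℝ) ^ (-(K * κ)) +
      (n + 1) * (2 * (Real.exp C * Real.exp (-(g * (n : ℝ) ^ κ)))))) with hRdef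
  have hR : Tendsto (fun n => R n * (n : ℝ) ^ ρ) atTop (𝓝 0) := by
    have h1 : Tendsto (fun n : ℕ => ∑ j ∈ J,
        (D j * ((n : ℝ) ^ (-(p * (s * (1 - κ) - κ - 1))) * (n : ℝ) ^ ρ) +
        (Real.exp C * ((n : ℝ) ^ (-(K * κ)) * (n : ℝ) ^ ρ) +
          2 * Real.exp C * (((n : ℝ) + 1) * Real.exp (-(g * (n : ℝ) ^ κ)) * (n : ℝ) ^ ρ))))
        atTop (𝓝 (∑ j ∈ J, (D j * 0 + (Real.exp C * 0 + 2 * Real.exp C * 0)))) :=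
      tendsto_finsetSum _ fun j _ =>
        ((tendsto_natCast_rpow_mul_rpow_neg hτ).const_mul _).add
          (((tendsto_natCast_rpow_mul_rpow_neg hK).const_mul _).add
            ((tendsto_natCast_mul_exp_neg_rpow_mul_rpow hg hκ ρ).const_mul _))
    simp only [mul_zero, add_zero, Finset.sum_const_zero] at h1
    refine h1.congr fun n => ?_
    rw [hRdef]
    simp only
    rw [Finset.sum_mul]
    exact Finset.sum_congr rfl fun j _ => by ring
  have hlim : Tendsto (fun n => ENNReal.ofReal (c⁻¹ * (R n * (n : ℝ) ^ ρ))) atTop (𝓝 0) := by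
    have := ENNReal.tendsto_ofReal (hR.const_mul c⁻¹)
    simpa using this
  have hzero : ∀ δ : ℝ, 0 < δ → 4 * (2 * q + 1) * K * δ ≤ γ → limsup
      (fun n : ℕ => P {ω | n * γ < smallJumpMax A Z q (n * δ) n ω} /
        ((n : ℝ≥0∞) * P {ω | (n : ℝ) < |Z 0 ω|})) atTop = 0 := by
    intro δ hδ hKδ
    have hlarge : ∀ᶠ n : ℕ in atTop, (2 * q + 1) * (n : ℝ) ^ (1 - κ) ≤ n * δ := by
      filter_upwards [((tendsto_rpow_atTop hκ).comp
        tendsto_natCast_atTop_atTop).eventually_ge_atTop ((2 * q + 1) / δ),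
        eventually_gt_atTop 0] with n hn hn0
      have hn0' : (0 : ℝ) < n := by exact_mod_cast hn0
      rw [Function.comp_apply, div_le_iff₀ hδ] at hn
      rw [sub_eq_add_neg, Real.rpow_add hn0', Real.rpow_one, Real.rpow_neg hn0'.le]
      have h0 : 0 < (n : ℝ) ^ κ := by positivity
      calc (2 * q + 1) * ((n : ℝ) * ((n : ℝ) ^ κ)⁻¹)
          ≤ ((n : ℝ) ^ κ * δ) * ((n : ℝ) * ((n : ℝ) ^ κ)⁻¹) := by gcongr
        _ = n * δ := by field_simp
    refine (tendsto_of_tendsto_of_tendsto_of_le_of_le' tendsto_const_nhds hlim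
      (Eventually.of_forall fun n => zero_le) ?_).limsup_eq
    filter_upwards [hlarge, eventually_gt_atTop 0,
      tendsto_natCast_atTop_atTop.eventually htail] with n hnM hn0 hnt
    have hn0' : (0 : ℝ) < n := by exact_mod_cast hn0
    have h1 := hX.measure_lt_smallJumpMax_le hα hs hs2 hsα hp hκ (q := q) hn0 hnM hKδ
    have h2 : P {ω | n * γ < smallJumpMax A Z q (n * δ) n ω} ≤ ENNReal.ofReal (R n) := by
      refine h1.trans (le_of_eq ?_)
      rw [hRdef, ENNReal.ofReal_sum_of_nonneg fun j _ => by positivity]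
      refine Finset.sum_congr rfl fun j hj => ?_
      rw [ENNReal.ofReal_add (by positivity) (by positivity),
        ENNReal.ofReal_add (by positivity) (by positivity),
        ENNReal.ofReal_mul (q := D j) (by positivity), ENNReal.ofReal_toReal (hA j hj).ne,
        ENNReal.ofReal_mul (p := (n : ℝ) + 1) (by positivity),
        ENNReal.ofReal_mul (p := (2 : ℝ)) (by positivity),
        ENNReal.ofReal_add (p := (n : ℝ)) (by positivity) (by positivity)]
      simp
      rfl
    have h3 : ENNReal.ofReal (c * (n : ℝ) ^ (-ρ)) ≤
        (n : ℝ≥0∞) * P {ω | (n : ℝ) < |Z 0 ω|} := by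
      rw [← ENNReal.ofReal_toReal (measure_ne_top P {ω | (n : ℝ) < |Z 0 ω|}),
        ← ENNReal.ofReal_natCast, ← ENNReal.ofReal_mul hn0'.le]
      apply ENNReal.ofReal_le_ofReal
      refine le_trans (le_of_eq ?_) (mul_le_mul_of_nonneg_left hnt hn0'.le)
      rw [show -ρ = -(ρ + 1) + 1 by ring, Real.rpow_add hn0', Real.rpow_one]
      ring
    refine (ENNReal.div_le_div h2 h3).trans (le_of_eq ?_)
    rw [← ENNReal.ofReal_div_of_pos (by positivity), Real.rpow_neg hn0'.le]
    congr 1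
    field_simp
  refine tendsto_const_nhds.congr' ?_
  have hδ₀ : 0 < γ / (4 * (2 * q + 1) * (K + 1)) := by positivity
  filter_upwards [Ioo_mem_nhdsGT hδ₀] with δ hδ
  refine (hzero δ hδ.1 ?_).symm
  have h := (lt_div_iff₀ (by positivity)).1 hδ.2
  have h0 : 0 < 4 * (2 * (q : ℝ) + 1) * δ := mul_pos (by positivity) hδ.1
  nlinarith

/-- Only individual moments slightly above `α` are needed, since `q` is finite. At `α = 2` a single
term is dominated by the sum inside the mixed moment. -/
theorem CoefficientMoments.exists_lintegral_lt_top {a : ℤ → Ω → ℝ}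
    (h : CoefficientMoments P a α) (hα : 1 < α) (hα2 : α ≤ 2) :
    ∃ ε : ℝ, 0 < ε ∧ ∀ j, ∫⁻ ω, ‖a j ω‖ₑ ^ (α + ε) ∂P < ∞ := by
  obtain ⟨ε, hε, hεα, h1, h2, -⟩ := h
  refine ⟨ε, hε, fun j => ?_⟩
  rcases hα2.lt_or_eq with hlt | heq
  · exact (ENNReal.le_tsum j).trans_lt (h1 hlt hα.ne').2
  · refine (lintegral_mono fun ω => ?_).trans_lt (h2 (Or.inr heq))
    have hpos : 0 < α - ε := by linarith
    calc ‖a j ω‖ₑ ^ (α + ε) = (‖a j ω‖ₑ ^ (α - ε)) ^ ((α + ε) / (α - ε)) := by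
          rw [← ENNReal.rpow_mul, mul_div_cancel₀ _ hpos.ne']
      _ ≤ _ := ENNReal.rpow_le_rpow (ENNReal.le_tsum (f := fun j => ‖a j ω‖ₑ ^ (α - ε)) j)
          (div_nonneg (by linarith) hpos.le)

end LinearProcess

end HeavyTail

theorem lemma7p4 {Ω : Type*} [MeasurableSpace Ω] (P : Measure Ω) [IsProbabilityMeasure P]
    (A : ℤ → ℤ → Ω → ℝ) (Z : ℤ → Ω → ℝ) (μ : Measure ℝ) (α : ℝ)
    (hX : HeavyTail.LinearProcessAssumptions P A Z μ α) :
    (1 < α → α ≤ 2 →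
      ∀ (q : ℕ) (γ : ℝ), 0 < γ → HeavyTail.SmallJumpMaximalCondition P A Z q γ) ∧
    (2 < α →
      ∀ q : ℕ,
        (∃ β : ℝ, α - 1 < β ∧
          ∀ j : ℤ, -(q : ℤ) ≤ j → j ≤ (q : ℤ) → ∫⁻ ω, ‖A 0 j ω‖ₑ ^ (2 * β) ∂P < ∞) →
        ∀ γ : ℝ, 0 < γ → HeavyTail.SmallJumpMaximalCondition P A Z q γ) := by
  constructor
  · intro hα hα2 q γ hγ
    obtain ⟨ε, hε, hA⟩ := hX.coeff_moments.exists_lintegral_lt_top hα hα2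
    -- With `p = (α + ε) / s`, the requirement `α - 1 < p * (s - 1)` is equivalent to `s > (α + ε) /
    -- (1 + ε)`, a threshold below `α` because `α > 1`.
    obtain ⟨s, hs1, hs2⟩ := exists_between
      (show max 1 ((α + ε) / (1 + ε)) < α from
        max_lt hα ((div_lt_iff₀ (by linarith)).2 (by nlinarith)))
    obtain ⟨hs, hs'⟩ := max_lt_iff.1 hs1
    have hs0 : 0 < s := by linarith
    rw [div_lt_iff₀ (by linarith)] at hs'
    refine hX.smallJumpMaximalCondition hα (p := (α + ε) / s) hs.le (by linarith) hs2
      ((one_le_div hs0).2 (by linarith)) ?_ (fun j _ => ?_) hγ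
    · rw [div_mul_eq_mul_div, lt_div_iff₀ hs0]
      nlinarith
    · rw [mul_div_cancel₀ _ hs0.ne']
      exact hA j
  · rintro hα q ⟨β, hβ, hA⟩ γ hγ
    -- With finite variance `s = 2` is allowed, and `α - 1 < p * (s - 1)` becomes exactly `α - 1 <
    -- β`.
    refine hX.smallJumpMaximalCondition (by linarith) (s := 2) (p := β) one_le_two le_rfl hα
      (by linarith) (by linarith) (fun j hj => ?_) hγ
    rw [Finset.mem_Icc] at hj
    exact hA j hj.1 hj.2
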